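/- **Setting.** For $k=1,2$ let $\mathcal E^{(k)},\mathcal S^{(k)}$ be disjoint finite sets, let $A^{(k)}_{\mathcal E\mathcal E}$ and $A^{(k)}_{\mathcal S\mathcal S}$ be intensity matrices on them, $r^{(k)}:\mathcal E^{(k)}\to\mathbb R\setminus\{0\}$ and $\rho^{(k)}:\mathcal S^{(k)}\to\mathbb R\setminus\{0\}$ reward rates, $P^{(k)}$ a stochastic matrix from $\mathcal E^{(k)}$ to $\mathcal S^{(k)}$, and $i^{(k)}\in\mathcal E^{(k)}$ an initial state. Let $\gamma_0>0$ be at least as large as the modulus of every diagonal entry of these intensity matrices. Let $\Theta^{(1)},\Theta^{(2)}$ be independent Poisson processes on $(0,\infty)$ of intensity $\gamma_0$. The ruin-dependent bivariate stochastic fluid process consists of càdlàg environments $J^{(k)}$ on $\mathcal E^{(k)}\cup\mathcal S^{(k)}$ with $J^{(k)}(0)=i^{(k)}$ and continuous levels $F^{(k)}$ with $F^{(k)}(0)=0$, where $F^{(k)}$ grows at rate $r^{(k)}(i)$ while $J^{(k)}=i\in\mathcal E^{(k)}$ and at rate $\rho^{(k)}(i)$ while $J^{(k)}=i\in\mathcal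 S^{(k)}$. Let $$\tau^{[1]}=\inf\{s>0: F^{(1)}(s)=0\text{ or }F^{(2)}(s)=0\}\in(0,\infty].$$ The environment $J^{(k)}$ is in $\mathcal E^{(k)}$ before $\tau^{[1]}$ and in $\mathcal S^{(k)}$ from $\tau^{[1]}$ on. It jumps only at points of $\Theta^{(k)}$ and at $\tau^{[1]}$: given all the Poisson times and the strict past of both environments, at a point of $\Theta^{(k)}$ it moves according to $I+\gamma_0^{-1}A^{(k)}_{\mathcal E\mathcal E}$ (before $\tau^{[1]}$) or $I+\gamma_0^{-1}A^{(k)}_{\mathcal S\mathcal S}$ (after $\tau^{[1]}$), and at $\tau^{[1]}$ the two environments switch independently of each other according to $P^{(1)}$ and $P^{(2)}$. The superscript $[1]$ denotes the (random) coordinate whose level is $0$ at $\tau^{[1]}$, and $[2]$ the other coordinate. For each $\gamma>\gamma_0$ let $\widehat\Theta^{(1)},\widehat\Theta^{(2)}$ be Poisson processes of intensity $\gamma-\gamma_0$ such that $\Theta^{(1)},\Theta^{(2)},\widehat\Theta^{(1)},\widehat\Theta^{(2)}$ are independent, and let $\widetilde\theta^{(k)}_1\le\widetilde\theta^{(k)}_2\le\cdots$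 be the points of the superposition of $\Theta^{(k)}$ and $\widehat\Theta^{(k)}$ (a Poisson process of intensity $\gamma$). On $\{\tau^{[1]}<\infty\}$ define $$\ell_*=\inf\{\ell\ge1:\ \tau^{[1]}<\widetilde\theta^{[1]}_\ell\},\qquad \sigma^{[1]}_*=\widetilde\theta^{[1]}_{\ell_*},\qquad \sigma^{[2]}_*=\widetilde\theta^{[2]}_{\ell_*}.$$ **Theorem.** Fix $\epsilon\in(0,1)$ and $q>0$. There exist functions $\delta(\gamma)=\delta(\gamma,\epsilon,q)$ and $K(\gamma)=K(\gamma,\epsilon,q)$, depending only on $\gamma,\epsilon,q$, such that, as $\gamma\to\infty$, $\delta(\gamma)/\big((\log\gamma)\gamma^{-1/2+\epsilon/2}\big)$ and $K(\gamma)/\gamma^{\epsilon}$ converge to positive finite constants, and for every such process and $k=1,2$, $$\mathbb P\left(|\tau^{[1]}-\sigma^{[k]}_*|>\delta(\gamma),\ \tau^{[1]}\le K(\gamma)\right)=o(\gamma^{-q})\qquad\text{as }\gamma\to\infty.$$ -/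

import Mathlib

open MeasureTheory ProbabilityTheory Filter Topology Asymptotics

universe u

/-- `θ 0 = 0 < θ 1 < θ 2 < …` are the successive arrival times of a homogeneous Poisson process of
intensity `rate` on `(0, ∞)`: the gaps are independent and exponential with parameter `rate`. -/
structure IsPoissonArrivals {Ω : Type*} [MeasurableSpace Ω] (P : Measure Ω) (rate : ℝ)
    (θ : ℕ → Ω → ℝ) : Prop where
  measurable : ∀ ℓ, Measurable (θ ℓ)
  zero : ∀ᵐ ω ∂P, θ 0 ω = 0
  gap_law : ∀ ℓ, P.map (fun ω => θ (ℓ + 1) ω - θ ℓ ω) = expMeasure rate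
  gap_indep : iIndepFun (fun ℓ ω => θ (ℓ + 1) ω - θ ℓ ω) P

/-- The `ℓ`-th arrival time (with arrival `0` at time `0`) of the superposition of the two point
configurations `{a 1, a 2, …}` and `{b 1, b 2, …}`: the first time by which at least `ℓ` points of
the two configurations together have arrived. -/
noncomputable def superposedArrival (a b : ℕ → ℝ) (ℓ : ℕ) : ℝ :=
  sInf {t : ℝ | 0 ≤ t ∧
    (ℓ : ℕ∞) ≤ {m : ℕ | 1 ≤ m ∧ a m ≤ t}.encard + {m : ℕ | 1 ≤ m ∧ b m ≤ t}.encard}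

/-- The parameters of a ruin-dependent bivariate stochastic fluid process. The coordinates `(1)` and
`(2)` are `0` and `1` in `Fin 2`. Coordinate `k` has the finite environment space `E k` before the
first ruin time and `S k` from then on. -/
structure FluidModel where
  E : Fin 2 → Type u
  S : Fin 2 → Type u
  fintypeE : ∀ k, Fintype (E k)
  fintypeS : ∀ k, Fintype (S k)
  decidableE : ∀ k, DecidableEq (E k)
  decidableS : ∀ k, DecidableEq (S k)
  /-- intensity matrices before and after the behavioral switch -/
  AE : ∀ k, Matrix (E k) (E k) ℝ
  AS : ∀ k, Matrix (S k) (S k) ℝ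
  AE_nonneg : ∀ k i j, i ≠ j → 0 ≤ AE k i j
  AS_nonneg : ∀ k i j, i ≠ j → 0 ≤ AS k i j
  AE_sum : ∀ k i, ∑ j, AE k i j = 0
  AS_sum : ∀ k i, ∑ j, AS k i j = 0
  /-- reward rates before and after the behavioral switch -/
  r : ∀ k, E k → ℝ
  ρ : ∀ k, S k → ℝ
  r_ne_zero : ∀ k i, r k i ≠ 0
  ρ_ne_zero : ∀ k i, ρ k i ≠ 0
  /-- transition matrices of the behavioral switch -/
  switch : ∀ k, Matrix (E k) (S k) ℝ
  switch_nonneg : ∀ k i j, 0 ≤ switch k i j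
  switch_sum : ∀ k i, ∑ j, switch k i j = 1
  /-- initial environment states -/
  init : ∀ k, E k
  /-- uniformization intensity -/
  γ₀ : ℝ
  γ₀_pos : 0 < γ₀
  AE_le : ∀ k i, |AE k i i| ≤ γ₀
  AS_le : ∀ k i, |AS k i i| ≤ γ₀

namespace FluidModel

attribute [instance] FluidModel.fintypeE FluidModel.fintypeS FluidModel.decidableE
  FluidModel.decidableS

variable (M : FluidModel) {Ω : Type*}

/-- Environment states of coordinate `k`: the disjoint union of `E k` and `S k`. -/
abbrev State (k : Fin 2) : Type _ := M.E k ⊕ M.S k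

/-- Reward rate of a state: `r` on `E k`, `ρ` on `S k`. -/
def reward (k : Fin 2) : M.State k → ℝ := Sum.elim (M.r k) (M.ρ k)

/-- Transition matrix `I + A / γ₀` of the uniformized environment (no transitions between `E k` and
`S k`). -/
noncomputable def uniformized (k : Fin 2) : Matrix (M.State k) (M.State k) ℝ :=
  Matrix.fromBlocks (1 + M.γ₀⁻¹ • M.AE k) 0 0 (1 + M.γ₀⁻¹ • M.AS k)

/-- The level process driven by the environment `J`. -/
noncomputable def level (J : ∀ k, ℝ → Ω → M.State k) (k : Fin 2) (t : ℝ) (ω : Ω) : ℝ :=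
  ∫ s in (0 : ℝ)..t, M.reward k (J k s ω)

/-- The first ruin time, with value `⊤` if neither level ever returns to `0`. -/
noncomputable def ruinTime (J : ∀ k, ℝ → Ω → M.State k) (ω : Ω) : EReal :=
  sInf ((fun s : ℝ => (s : EReal)) '' {s : ℝ | 0 < s ∧ ∃ k, M.level J k s ω = 0})

/-- `J k` has the left limit `x` at time `u`, that is, `J k (u-) = x`. -/
def LeftState (J : ∀ k, ℝ → Ω → M.State k) (k : Fin 2) (u : ℝ) (ω : Ω) (x : M.State k) : Prop :=
  ∀ᶠ s in 𝓝[<] u, J k s ω = x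

/-- The σ-algebra generated by all the Poisson times of both coordinates and by both environments
strictly before the random time `T`. -/
@[reducible] def strictPast (θ : Fin 2 → ℕ → Ω → ℝ) (J : ∀ k, ℝ → Ω → M.State k) (T : Ω → EReal) :
    MeasurableSpace Ω :=
  MeasurableSpace.generateFrom
    ({A | ∃ (k : Fin 2) (ℓ : ℕ) (a : ℝ), A = {ω | θ k ℓ ω ≤ a}} ∪
      {A | ∃ (k : Fin 2) (s : ℝ) (x : M.State k), 0 ≤ s ∧
        A = {ω | (s : EReal) < T ω ∧ J k s ω = x}})

/-- `J` is the pair of environments of a ruin-dependent bivariate stochastic fluid process with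
parameters `M`, constructed by uniformization on the Poisson times `θ`. -/
structure IsRuinFluidPair [MeasurableSpace Ω] (P : Measure Ω) (θ : Fin 2 → ℕ → Ω → ℝ)
    (J : ∀ k, ℝ → Ω → M.State k) : Prop where
  poisson : ∀ k, IsPoissonArrivals P M.γ₀ (θ k)
  indep : IndepFun (fun ω ℓ => θ 0 ℓ ω) (fun ω ℓ => θ 1 ℓ ω) P
  measurable : ∀ k t x, MeasurableSet {ω | J k t ω = x}
  initial : ∀ᵐ ω ∂P, ∀ k, J k 0 ω = Sum.inl (M.init k)
  /-- `J k` is constant from each of its epochs (Poisson time or ruin time) to the next one. -/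
  constant : ∀ᵐ ω ∂P, ∀ (k : Fin 2) (s t : ℝ), 0 ≤ s → s ≤ t →
    (∀ ℓ, ¬ (s < θ k ℓ ω ∧ θ k ℓ ω ≤ t)) →
    ¬ ((s : EReal) < M.ruinTime J ω ∧ M.ruinTime J ω ≤ (t : EReal)) → J k t ω = J k s ω
  /-- The environments live in `E` before the first ruin time and in `S` from then on. -/
  phase : ∀ᵐ ω ∂P, ∀ (k : Fin 2) (t : ℝ), 0 ≤ t →
    ((t : EReal) < M.ruinTime J ω → ∃ i, J k t ω = Sum.inl i) ∧
    (M.ruinTime J ω ≤ (t : EReal) → ∃ j, J k t ω = Sum.inr j)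
  /-- At a Poisson time other than the ruin time, given the Poisson times and the strict past, the
  environment of that coordinate moves according to `I + A / γ₀`. -/
  jump : ∀ (k : Fin 2) (ℓ : ℕ), 1 ≤ ℓ → ∀ (x y : M.State k) (H : Set Ω),
    MeasurableSet[M.strictPast θ J (fun ω => (θ k ℓ ω : EReal))] H →
    P.real {ω | ω ∈ H ∧ (θ k ℓ ω : EReal) ≠ M.ruinTime J ω ∧
        M.LeftState J k (θ k ℓ ω) ω x ∧ J k (θ k ℓ ω) ω = y} =
      M.uniformized k x y *
        P.real {ω | ω ∈ H ∧ (θ k ℓ ω : EReal) ≠ M.ruinTime J ω ∧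
          M.LeftState J k (θ k ℓ ω) ω x}
  /-- At the first ruin time, given the Poisson times and the strict past, the environments switch
  independently of each other according to the matrices `switch`. -/
  switching : ∀ (x : ∀ k, M.E k) (y : ∀ k, M.S k) (H : Set Ω),
    MeasurableSet[M.strictPast θ J (M.ruinTime J)] H →
    P.real {ω | ω ∈ H ∧ M.ruinTime J ω ≠ ⊤ ∧
        (∀ k, M.LeftState J k (M.ruinTime J ω).toReal ω (Sum.inl (x k))) ∧
        ∀ k, J k (M.ruinTime J ω).toReal ω = Sum.inr (y k)} =
      (∏ k, M.switch k (x k) (y k)) *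
        P.real {ω | ω ∈ H ∧ M.ruinTime J ω ≠ ⊤ ∧
          ∀ k, M.LeftState J k (M.ruinTime J ω).toReal ω (Sum.inl (x k))}

/-- `θhat γ 0` and `θhat γ 1` are the additional Poisson processes of intensity `γ - γ₀`, for every
`γ > γ₀`; they are independent of each other and of the Poisson times `θ`. Nothing is assumed
about the joint law for different values of `γ`. -/
structure IsRefinement [MeasurableSpace Ω] (P : Measure Ω) (θ : Fin 2 → ℕ → Ω → ℝ)
    (θhat : ℝ → Fin 2 → ℕ → Ω → ℝ) : Prop where
  poisson : ∀ γ, M.γ₀ < γ → ∀ k, IsPoissonArrivals P (γ - M.γ₀) (θhat γ k)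
  indep : ∀ γ, M.γ₀ < γ →
    iIndepFun (fun (i : Fin 2 ⊕ Fin 2) (ω : Ω) =>
      Sum.elim (fun k ℓ => θ k ℓ ω) (fun k ℓ => θhat γ k ℓ ω) i) P

/-- The coordinate that is called `[1]` (for `k = 0`) or `[2]` (for `k = 1`): `[1]` is the
coordinate whose level is `0` at the first ruin time, and `[2]` is the other one. -/
noncomputable def ruinOrder (J : ∀ k, ℝ → Ω → M.State k) (ω : Ω) (k : Fin 2) : Fin 2 :=
  open Classical in
  let first : Fin 2 := if M.level J 0 (M.ruinTime J ω).toReal ω = 0 then 0 else 1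
  if k = 0 then first else first.rev

/-- The `ℓ`-th point of the refined Poisson grid of the coordinate called `[1]` (`k = 0`) or `[2]`
(`k = 1`). -/
noncomputable def grid (θ : Fin 2 → ℕ → Ω → ℝ) (J : ∀ k, ℝ → Ω → M.State k)
    (θhat : Fin 2 → ℕ → Ω → ℝ) (k : Fin 2) (ℓ : ℕ) (ω : Ω) : ℝ :=
  superposedArrival (fun m => θ (M.ruinOrder J ω k) m ω)
    (fun m => θhat (M.ruinOrder J ω k) m ω) ℓ

/-- The index of the first point of the refined grid of coordinate `[1]` after the first ruin time
(meaningful when that time is finite). -/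
noncomputable def lStar (θ : Fin 2 → ℕ → Ω → ℝ) (J : ∀ k, ℝ → Ω → M.State k)
    (θhat : Fin 2 → ℕ → Ω → ℝ) (ω : Ω) : ℕ :=
  sInf {ℓ : ℕ | 1 ≤ ℓ ∧ M.ruinTime J ω < (M.grid θ J θhat 0 ℓ ω : EReal)}

/-- The approximate switching times: the `lStar`-th point of the refined grid of coordinate `[1]`
(`k = 0`) or `[2]` (`k = 1`). -/
noncomputable def sigmaStar (θ : Fin 2 → ℕ → Ω → ℝ) (J : ∀ k, ℝ → Ω → M.State k)
    (θhat : Fin 2 → ℕ → Ω → ℝ) (k : Fin 2) (ω : Ω) : ℝ :=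
  M.grid θ J θhat k (M.lStar θ J θhat ω) ω

end FluidModel

/-! The estimate is pathwise in the Poisson grids and uniform in the ruin time, so the joint law of
ruin and grids plays no role. Put β = γ - γ₀. With overwhelming probability, in both coordinates,
the original process has fewer than n ≈ γ^((1+ε)/2) points up to K + 1, and the added points
numbered at most N ≈ 3γ^(1+ε) lie within x of their means ℓ/β (`IsRegularGrid`). The ℓ-th point of
either refined grid then lies below ℓ/β + x and, unless it is beyond K + 1, above (ℓ - n)/β - x.
Since τ lies between two consecutive points of grid [1], both grids at the index `lStar` are within
(n+1)/β + 2x of τ (`abs_ruinTime_sub_sigmaStar_le`).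

Chernoff bounds and a union bound control the exceptional event
(`measureReal_not_isRegularGrid_le`). `eventually_chernoff_bound_le` chooses the parameters: n/β is
of order γ^(-1/2+ε/2), and the logarithm in δ makes the deviation probability as small a power of γ
as desired. -/

/-- The moment generating function of the exponential distribution with parameter `r`. -/
lemma mgf_id_expMeasure {r v : ℝ} (hr : 0 < r) (hv : v < r) :
    mgf id (expMeasure r) v = r / (r - v) := by
  have hlt : ∀ᵐ x : ℝ, gammaPDF 1 r x < ⊤ := .of_forall fun x => ENNReal.ofReal_lt_top
  have hm : Measurable (gammaPDF 1 r) := (measurable_gammaPDFReal 1 r).ennreal_ofReal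
  rw [mgf, expMeasure, gammaMeasure, integral_withDensity_eq_integral_toReal_smul hm hlt]
  have hfun : ∀ x : ℝ, (gammaPDF 1 r x).toReal • Real.exp (v * id x) =
      (Set.Ici (0 : ℝ)).indicator (fun x => r * Real.exp ((v - r) * x)) x := by
    intro x
    rw [gammaPDF, ENNReal.toReal_ofReal (gammaPDFReal_nonneg one_pos hr x)]
    by_cases hx : 0 ≤ x
    · rw [Set.indicator_of_mem (Set.mem_Ici.mpr hx), gammaPDFReal, if_pos hx]
      simp only [Real.rpow_one, Real.Gamma_one, div_one, sub_self, Real.rpow_zero, mul_one,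
        smul_eq_mul, id]
      rw [mul_assoc, ← Real.exp_add]
      ring_nf
    · rw [Set.indicator_of_notMem (by simpa using hx), gammaPDFReal, if_neg hx, zero_smul]
  simp_rw [hfun]
  rw [integral_indicator measurableSet_Ici, integral_Ici_eq_integral_Ioi, integral_const_mul,
    integral_exp_mul_Ioi (by linarith)]
  have h1 : v - r ≠ 0 := by linarith
  have h2 : r - v ≠ 0 := by linarith
  simp only [mul_zero, Real.exp_zero]
  field_simp
  ring

lemma ae_nonneg_expMeasure (r : ℝ) : ∀ᵐ x ∂expMeasure r, 0 ≤ x := by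
  rw [ae_iff, expMeasure, gammaMeasure]
  have : {x : ℝ | ¬ 0 ≤ x} = Set.Iio 0 := by ext; simp
  rw [this, withDensity_apply _ measurableSet_Iio]
  exact lintegral_gammaPDF_of_nonpos le_rfl

/-- `-u - log (1 - u) ≤ u ^ 2` for `|u| ≤ 1 / 2`, in exponential form. -/
lemma inv_one_sub_le_exp {u : ℝ} (hu : |u| ≤ 1 / 2) : (1 - u)⁻¹ ≤ Real.exp (u + u ^ 2) := by
  obtain ⟨h1, h2⟩ := abs_le.mp hu
  rw [inv_le_iff_one_le_mul₀ (by linarith)]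
  rcases le_total 0 u with h0 | h0
  -- The linear bound on exp gives (1 + u + u²)(1 - u) = 1 - u³, which suffices only for u ≤ 0; here
  -- the quadratic term is needed.
  · have h3 := Real.quadratic_le_exp_of_nonneg (by positivity : 0 ≤ u + u ^ 2)
    have h4 : (1 + (u + u ^ 2) + (u + u ^ 2) ^ 2 / 2) * (1 - u) =
        1 + u ^ 2 * ((1 - u - u ^ 2 - u ^ 3) / 2) := by ring
    have h5 : u ^ 2 ≤ (1 / 2) ^ 2 := by gcongr
    have h6 : u ^ 3 ≤ (1 / 2) ^ 3 := by gcongr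
    have h7 : 0 ≤ u ^ 2 * ((1 - u - u ^ 2 - u ^ 3) / 2) :=
      mul_nonneg (sq_nonneg u) (by norm_num at h5 h6; linarith)
    calc 1 ≤ (1 + (u + u ^ 2) + (u + u ^ 2) ^ 2 / 2) * (1 - u) := by linarith
      _ ≤ _ := mul_le_mul_of_nonneg_right h3 (by linarith)
  · have h3 := Real.add_one_le_exp (u + u ^ 2)
    have h4 : 0 ≤ u ^ 2 * (-u) := mul_nonneg (sq_nonneg u) (by linarith)
    calc 1 ≤ (u + u ^ 2 + 1) * (1 - u) := by linarith
      _ ≤ _ := mul_le_mul_of_nonneg_right h3 (by linarith)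

/-! ### Tail bounds for Poisson arrival times -/

namespace IsPoissonArrivals

variable {Ω : Type*} [MeasurableSpace Ω] {P : Measure Ω} {rate : ℝ} {θ : ℕ → Ω → ℝ}

lemma ae_monotone (h : IsPoissonArrivals P rate θ) :
    ∀ᵐ ω ∂P, (Monotone fun m => θ m ω) ∧ θ 0 ω = 0 := by
  have hgap : ∀ ℓ, ∀ᵐ ω ∂P, 0 ≤ θ (ℓ + 1) ω - θ ℓ ω := fun ℓ =>
    ae_of_ae_map ((h.measurable _).sub (h.measurable _)).aemeasurable
      (h.gap_law ℓ ▸ ae_nonneg_expMeasure rate)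
  filter_upwards [ae_all_iff.mpr hgap, h.zero] with ω hω h0
  exact ⟨monotone_nat_of_le_succ fun ℓ => sub_nonneg.mp (hω ℓ), h0⟩

/-- The moment generating function of the `ℓ`-th arrival time (a Gamma distribution). -/
lemma mgf_eq (h : IsPoissonArrivals P rate θ) (hr : 0 < rate) {v : ℝ} (hv : v < rate) (ℓ : ℕ) :
    mgf (θ ℓ) P v = (rate / (rate - v)) ^ ℓ := by
  have hmeas : ∀ ℓ, Measurable (fun ω => θ (ℓ + 1) ω - θ ℓ ω) := fun ℓ =>
    (h.measurable _).sub (h.measurable _)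
  have hae : θ ℓ =ᵐ[P] ∑ i ∈ Finset.range ℓ, fun ω => θ (i + 1) ω - θ i ω := by
    filter_upwards [h.zero] with ω h0
    rw [Finset.sum_apply, Finset.sum_range_sub (fun i => θ i ω), h0, sub_zero]
  have hone : ∀ i, mgf (fun ω => θ (i + 1) ω - θ i ω) P v = rate / (rate - v) := fun i => by
    rw [← mgf_id_map (hmeas i).aemeasurable, h.gap_law i, mgf_id_expMeasure hr hv]
  rw [mgf_congr hae, h.gap_indep.mgf_sum hmeas]
  simp_rw [hone, Finset.prod_const, Finset.card_range]

lemma integrable_exp (h : IsPoissonArrivals P rate θ) (hr : 0 < rate) {v : ℝ} (hv : v < rate)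
    (ℓ : ℕ) : Integrable (fun ω => Real.exp (v * θ ℓ ω)) P := by
  -- The Bochner integral of a non-integrable function is 0, so the nonzero closed form already
  -- forces integrability.
  refine Integrable.of_integral_ne_zero ?_
  change mgf (θ ℓ) P v ≠ 0
  rw [h.mgf_eq hr hv]
  exact pow_ne_zero _ (div_pos hr (sub_pos.mpr hv)).ne'

/-- Many points of a Poisson process are unlikely to arrive early. -/
lemma measureReal_le_le [IsFiniteMeasure P] (h : IsPoissonArrivals P rate θ) (hr : 0 < rate) (T : ℝ) (m : ℕ) :
    P.real {ω | θ m ω ≤ T} ≤ Real.exp (rate * T) * (1 / 2) ^ m := by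
  -- The tilt `-rate` makes each gap contribute rate / (2 rate) = 1/2.
  have := measure_le_le_exp_mul_mgf (μ := P) (X := θ m) (t := -rate) T (by linarith)
    (h.integrable_exp hr (by linarith) m)
  rwa [h.mgf_eq hr (by linarith), neg_neg, sub_neg_eq_add, ← two_mul, div_mul_cancel_right₀ hr.ne',
    ← one_div] at this

lemma mgf_le (h : IsPoissonArrivals P rate θ) (hr : 0 < rate) {s : ℝ} (hs : |s| ≤ rate / 2)
    (ℓ : ℕ) : mgf (θ ℓ) P s ≤ Real.exp (s * (ℓ / rate) + ℓ * (s / rate) ^ 2) := by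
  have hs' : s < rate := by linarith [le_abs_self s]
  have hu : |s / rate| ≤ 1 / 2 := by
    rw [abs_div, abs_of_pos hr, div_le_iff₀ hr]; linarith
  have h1 : rate / (rate - s) = (1 - s / rate)⁻¹ := by
    have : rate - s ≠ 0 := by linarith
    field_simp
  rw [h.mgf_eq hr hs', h1]
  have h2 : 0 ≤ (1 - s / rate)⁻¹ := inv_nonneg.mpr (by linarith [(abs_le.mp hu).2])
  calc ((1 - s / rate)⁻¹) ^ ℓ ≤ Real.exp (s / rate + (s / rate) ^ 2) ^ ℓ := by
        gcongr; exact inv_one_sub_le_exp hu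
    _ = _ := by rw [← Real.exp_nat_mul]; ring_nf

/-- Chernoff bound for the `ℓ`-th arrival time around its mean. -/
lemma measureReal_abs_sub_ge_le [IsFiniteMeasure P] (h : IsPoissonArrivals P rate θ) (hr : 0 < rate) {s : ℝ}
    (hs₀ : 0 ≤ s) (hs : s ≤ rate / 2) (x : ℝ) (ℓ : ℕ) :
    P.real {ω | x ≤ |θ ℓ ω - ℓ / rate|} ≤ 2 * Real.exp (-(s * x) + ℓ * (s / rate) ^ 2) := by
  have hsub : {ω | x ≤ |θ ℓ ω - ℓ / rate|} ⊆
      {ω | ℓ / rate + x ≤ θ ℓ ω} ∪ {ω | θ ℓ ω ≤ ℓ / rate - x} := by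
    intro ω hω
    simp only [Set.mem_union, Set.mem_ofPred_eq, le_abs] at hω ⊢
    rcases hω with h1 | h1
    · left; linarith
    · right; linarith
  have hab : |s| ≤ rate / 2 := by rwa [abs_of_nonneg hs₀]
  have h1 := measure_ge_le_exp_mul_mgf (μ := P) (X := θ ℓ) (t := s) (ℓ / rate + x) hs₀
    (h.integrable_exp hr (by linarith) ℓ)
  have h2 := measure_le_le_exp_mul_mgf (μ := P) (X := θ ℓ) (t := -s) (ℓ / rate - x) (by linarith)
    (h.integrable_exp hr (by linarith) ℓ)
  have h3 : Real.exp (-s * (ℓ / rate + x)) * mgf (θ ℓ) P s ≤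
      Real.exp (-(s * x) + ℓ * (s / rate) ^ 2) := by
    refine (mul_le_mul_of_nonneg_left (h.mgf_le hr hab ℓ) (Real.exp_pos _).le).trans_eq ?_
    rw [← Real.exp_add]; ring_nf
  have h4 : Real.exp (- -s * (ℓ / rate - x)) * mgf (θ ℓ) P (-s) ≤
      Real.exp (-(s * x) + ℓ * (s / rate) ^ 2) := by
    refine (mul_le_mul_of_nonneg_left (h.mgf_le hr (by rwa [abs_neg]) ℓ) (Real.exp_pos _).le).trans_eq ?_
    rw [← Real.exp_add]; ring_nf
  calc _ ≤ _ := measureReal_mono hsub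
    _ ≤ _ := measureReal_union_le _ _
    _ ≤ _ := by linarith

end IsPoissonArrivals

/-! ### Deterministic bounds for superposed grids -/

lemma encard_setOf_le_of_lt {b : ℕ → ℝ} (hb : Monotone b) {j : ℕ} {t : ℝ} (h : t < b j) :
    {m : ℕ | 1 ≤ m ∧ b m ≤ t}.encard ≤ (j - 1 : ℕ) := by
  have hsub : {m : ℕ | 1 ≤ m ∧ b m ≤ t} ⊆ (Finset.Icc 1 (j - 1) : Finset ℕ) := by
    rintro m ⟨h1, h2⟩
    have : m < j := hb.reflect_lt (h2.trans_lt h)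
    simp only [Finset.coe_Icc, Set.mem_Icc]
    omega
  refine (Set.encard_le_encard hsub).trans ?_
  rw [Set.encard_coe_eq_coe_finsetCard]
  simp

/-- The points of `b` alone suffice for the count. This bounds the infimum above and also shows that
it is not the default value of `sInf ∅`. -/
lemma mem_superposedArrival_set {a b : ℕ → ℝ} (hb : Monotone b) (hb₀ : b 0 = 0) (ℓ : ℕ) :
    b ℓ ∈ {t : ℝ | 0 ≤ t ∧
      (ℓ : ℕ∞) ≤ {m : ℕ | 1 ≤ m ∧ a m ≤ t}.encard + {m : ℕ | 1 ≤ m ∧ b m ≤ t}.encard} := by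
  refine ⟨hb₀ ▸ hb (Nat.zero_le ℓ), le_add_left ?_⟩
  have hsub : ((Finset.Icc 1 ℓ : Finset ℕ) : Set ℕ) ⊆ {m : ℕ | 1 ≤ m ∧ b m ≤ b ℓ} := by
    intro m hm
    simp only [Finset.coe_Icc, Set.mem_Icc] at hm
    exact ⟨hm.1, hb hm.2⟩
  refine le_trans ?_ (Set.encard_le_encard hsub)
  rw [Set.encard_coe_eq_coe_finsetCard]
  simp

/-- Superposing more points brings the arrival times forward. -/
lemma superposedArrival_le {a b : ℕ → ℝ} (hb : Monotone b) (hb₀ : b 0 = 0) (ℓ : ℕ) :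
    superposedArrival a b ℓ ≤ b ℓ :=
  csInf_le ⟨0, fun _ ht => ht.1⟩ (mem_superposedArrival_set hb hb₀ ℓ)

/-- As long as fewer than `n` points of `a` have arrived, the superposition is at most `n` points
ahead of `b`. -/
lemma min_le_superposedArrival {a b : ℕ → ℝ} (ha : Monotone a) (hb : Monotone b) (hb₀ : b 0 = 0)
    {n : ℕ} (hn : 1 ≤ n) (ℓ : ℕ) :
    min (a n) (b (ℓ - n)) ≤ superposedArrival a b ℓ := by
  refine le_csInf ⟨_, mem_superposedArrival_set hb hb₀ ℓ⟩ ?_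
  rintro t ⟨ht₀, ht⟩
  by_contra! hlt
  obtain ⟨h1, h2⟩ := lt_min_iff.mp hlt
  -- If ℓ ≤ n, then b (ℓ - n) = b 0 = 0 and t would be negative; hence the subtraction is not
  -- truncated.
  have hj : ℓ - n ≠ 0 := fun h => by rw [h, hb₀] at h2; linarith
  have h3 : (ℓ : ℕ∞) ≤ ((n - 1 + (ℓ - n - 1) : ℕ) : ℕ∞) := by
    push_cast
    exact ht.trans (add_le_add (encard_setOf_le_of_lt ha h1)
      (encard_setOf_le_of_lt hb h2))
  have h4 := Nat.cast_le.mp h3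
  omega

/-- The pathwise bounds on a Poisson grid that make the approximate switching times accurate: the
points `b` are close to their means, and the additional points `a` are sparse. -/
structure IsRegularGrid (β x T : ℝ) (n N : ℕ) (a b : ℕ → ℝ) : Prop where
  mono_left : Monotone a
  mono_right : Monotone b
  zero_right : b 0 = 0
  lt_left : T < a n
  abs_sub_lt : ∀ ℓ ≤ N, |b ℓ - ℓ / β| < x

namespace IsRegularGrid

variable {β x T : ℝ} {n N : ℕ} {a b : ℕ → ℝ}

lemma superposedArrival_lt (h : IsRegularGrid β x T n N a b) {ℓ : ℕ} (hℓ : ℓ ≤ N) :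
    superposedArrival a b ℓ < ℓ / β + x := by
  have := (abs_lt.mp (h.abs_sub_lt ℓ hℓ)).2
  linarith [superposedArrival_le (a := a) h.mono_right h.zero_right ℓ]

lemma superposedArrival_zero_le (h : IsRegularGrid β x T n N a b) :
    superposedArrival a b 0 ≤ 0 :=
  (superposedArrival_le h.mono_right h.zero_right 0).trans_eq h.zero_right

lemma min_lt_superposedArrival (h : IsRegularGrid β x T n N a b) (hβ : 0 < β) (hn : 1 ≤ n) {ℓ : ℕ}
    (hℓ : ℓ ≤ N) : min T ((ℓ - n) / β - x) < superposedArrival a b ℓ := by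
  refine lt_of_lt_of_le ?_
    (min_le_superposedArrival h.mono_left h.mono_right h.zero_right hn ℓ)
  have h1 := (abs_lt.mp (h.abs_sub_lt (ℓ - n) ((Nat.sub_le _ _).trans hℓ))).1
  -- Truncated subtraction only increases the value, so ℓ < n needs no separate treatment.
  have h2 : ((ℓ : ℝ) - n) / β ≤ ((ℓ - n : ℕ) : ℝ) / β := by
    gcongr
    rw [sub_le_iff_le_add]
    exact_mod_cast le_tsub_add
  refine lt_min ((min_le_left _ _).trans_lt h.lt_left) ((min_le_right _ _).trans_lt ?_)
  linarith

end IsRegularGrid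

/-! ### Pathwise accuracy of the switching times -/

namespace FluidModel

variable (M : FluidModel) {Ω : Type*} {θ : Fin 2 → ℕ → Ω → ℝ} {J : ∀ k, ℝ → Ω → M.State k}
  {θh : Fin 2 → ℕ → Ω → ℝ} {ω : Ω} {β x K T : ℝ} {n N : ℕ}

lemma ruinTime_nonneg (J : ∀ k, ℝ → Ω → M.State k) (ω : Ω) : 0 ≤ M.ruinTime J ω := by
  refine le_sInf ?_
  rintro _ ⟨s, ⟨hs, -⟩, rfl⟩
  exact EReal.coe_nonneg.mpr hs.le

lemma coe_toReal_ruinTime (h : M.ruinTime J ω ≤ (K : EReal)) :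
    (((M.ruinTime J ω).toReal : ℝ) : EReal) = M.ruinTime J ω :=
  EReal.coe_toReal (fun h' => by simp [h'] at h)
    (fun h' => by have := M.ruinTime_nonneg J ω; simp [h'] at this)

/-- On regular grids the approximate switching times are close to the ruin time. -/
lemma abs_ruinTime_sub_sigmaStar_le (hβ : 0 < β) (hn : 1 ≤ n) (hKT : K < T)
    (hN : K < (N - n) / β - x) (h : ∀ c, IsRegularGrid β x T n N (θ c · ω) (θh c · ω))
    (hτ : M.ruinTime J ω ≤ (K : EReal)) (k : Fin 2) :
    |(M.ruinTime J ω).toReal - M.sigmaStar θ J θh k ω| ≤ (n + 1) / β + 2 * x := by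
  set τ := (M.ruinTime J ω).toReal with hτ_def
  have hcoe : M.ruinTime J ω = (τ : EReal) := (M.coe_toReal_ruinTime hτ).symm
  have hτ₀ : 0 ≤ τ := EReal.toReal_nonneg (M.ruinTime_nonneg J ω)
  have hτK : τ ≤ K := by rwa [hcoe, EReal.coe_le_coe_iff] at hτ
  have hgrid : ∀ k, IsRegularGrid β x T n N (fun m => θ (M.ruinOrder J ω k) m ω)
    (fun m => θh (M.ruinOrder J ω k) m ω) := fun k => h _
  have hlower : ∀ k, ∀ ℓ ≤ N, min T ((ℓ - n) / β - x) < M.grid θ J θh k ℓ ω :=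
    fun k ℓ hℓ => (hgrid k).min_lt_superposedArrival hβ hn hℓ
  have hupper : ∀ k, ∀ ℓ ≤ N, M.grid θ J θh k ℓ ω < ℓ / β + x :=
    fun k ℓ hℓ => (hgrid k).superposedArrival_lt hℓ
  have hx : 0 < x := (abs_nonneg _).trans_lt ((hgrid 0).abs_sub_lt 0 (Nat.zero_le _))
  have hN₁ : 1 ≤ N := by
    by_contra! hN₀
    obtain rfl : N = 0 := by omega
    have : ((0 : ℕ) - n : ℝ) / β ≤ 0 := div_nonpos_of_nonpos_of_nonneg (by simp) hβ.le
    linarith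
  have hset : {ℓ : ℕ | 1 ≤ ℓ ∧ M.ruinTime J ω < (M.grid θ J θh 0 ℓ ω : EReal)} =
      {ℓ : ℕ | 1 ≤ ℓ ∧ τ < M.grid θ J θh 0 ℓ ω} := by
    simp only [hcoe, EReal.coe_lt_coe_iff]
  -- The grid passes K by index N, so `lStar` is a true minimum and the deviation bounds apply at
  -- it.
  have hNmem : N ∈ {ℓ : ℕ | 1 ≤ ℓ ∧ τ < M.grid θ J θh 0 ℓ ω} :=
    ⟨hN₁, hτK.trans_lt ((lt_min hKT hN).trans (hlower 0 N le_rfl))⟩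
  have hl : M.lStar θ J θh ω = sInf {ℓ : ℕ | 1 ≤ ℓ ∧ τ < M.grid θ J θh 0 ℓ ω} := by
    rw [lStar, hset]
  set l := M.lStar θ J θh ω with hl_def
  have hlN : l ≤ N := hl ▸ Nat.sInf_le hNmem
  obtain ⟨hl₁, hl₂⟩ : 1 ≤ l ∧ τ < M.grid θ J θh 0 l ω := hl ▸ Nat.sInf_mem ⟨N, hNmem⟩
  -- Minimality of l gives this except at index 0, which the defining set excludes; there the grid
  -- value is at most 0.
  have hprev : M.grid θ J θh 0 (l - 1) ω ≤ τ := by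
    rcases Nat.eq_zero_or_pos (l - 1) with h0 | h0
    · rw [h0]; exact (hgrid 0).superposedArrival_zero_le.trans hτ₀
    · by_contra! hlt
      have : l ≤ l - 1 := hl.trans_le (Nat.sInf_le ⟨h0, hlt⟩)
      omega
  have h1 : ((l : ℝ) - 1 - n) / β - x < τ := by
    have := (hlower 0 (l - 1) ((Nat.sub_le _ _).trans hlN)).trans_le hprev
    rw [Nat.cast_sub hl₁, Nat.cast_one] at this
    exact (min_lt_iff.mp this).resolve_left (by linarith)
  have h2 : τ < l / β + x := hl₂.trans (hupper 0 l hlN)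
  have h3 := hupper k l hlN
  have h4 := hlower k l hlN
  have e1 : ((l : ℝ) - 1 - n) / β = l / β - (n + 1) / β := by ring
  have e2 : ((l : ℝ) - n) / β = l / β - n / β := by ring
  have e3 : ((n : ℝ) + 1) / β = n / β + 1 / β := by ring
  have e4 : 0 < 1 / β := by positivity
  have e5 : 0 ≤ (n : ℝ) / β := by positivity
  change |τ - M.grid θ J θh k l ω| ≤ _
  rw [abs_le]
  constructor
  · linarith
  -- If the grid point is beyond T, it already exceeds τ ≤ K < T.
  · rcases min_lt_iff.mp h4 with h5 | h5 <;> linarith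

end FluidModel

/-! ### Probability of irregular grids -/

section Probability

variable {Ω : Type*} [MeasurableSpace Ω] {P : Measure Ω} [IsFiniteMeasure P]

lemma measureReal_not_isRegularGrid_le {α β s x T : ℝ} {a b : ℕ → Ω → ℝ}
    (ha : IsPoissonArrivals P α a) (hb : IsPoissonArrivals P β b) (hα : 0 < α) (hβ : 0 < β)
    (hs₀ : 0 ≤ s) (hs : s ≤ β / 2) (n N : ℕ) :
    P.real {ω | ¬ IsRegularGrid β x T n N (a · ω) (b · ω)} ≤
      Real.exp (α * T) * (1 / 2) ^ n +
        (N + 1) * (2 * Real.exp (-(s * x) + N * (s / β) ^ 2)) := by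
  have hsub : {ω | ¬ IsRegularGrid β x T n N (a · ω) (b · ω)} ≤ᵐ[P]
      ({ω | a n ω ≤ T} ∪ ⋃ ℓ ∈ Finset.range (N + 1), {ω | x ≤ |b ℓ ω - ℓ / β|} : Set Ω) := by
    filter_upwards [ha.ae_monotone, hb.ae_monotone] with ω h1 h2 h3
    by_contra h4
    refine h3 ⟨h1.1, h2.1, h2.2, not_le.mp fun h => h4 (Or.inl h), fun ℓ hℓ => not_le.mp fun h =>
      h4 (Or.inr (Set.mem_biUnion (Finset.mem_coe.mpr (Finset.mem_range_succ_iff.mpr hℓ)) h))⟩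
  have hterm : ∀ ℓ ∈ Finset.range (N + 1), P.real {ω | x ≤ |b ℓ ω - ℓ / β|} ≤
      2 * Real.exp (-(s * x) + N * (s / β) ^ 2) := fun ℓ hℓ => by
    refine (hb.measureReal_abs_sub_ge_le hβ hs₀ hs x ℓ).trans ?_
    have : (ℓ : ℝ) ≤ N := by exact_mod_cast Finset.mem_range_succ_iff.mp hℓ
    gcongr
  calc _ ≤ P.real ({ω | a n ω ≤ T} ∪
          ⋃ ℓ ∈ Finset.range (N + 1), {ω | x ≤ |b ℓ ω - ℓ / β|} : Set Ω) :=
        ENNReal.toReal_mono (measure_ne_top _ _) (measure_mono_ae hsub)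
    _ ≤ _ := measureReal_union_le _ _
    _ ≤ _ := add_le_add (ha.measureReal_le_le hα T n)
        ((measureReal_biUnion_finset_le _ _).trans (Finset.sum_le_sum hterm))
    _ = _ := by simp

/-- The labels [1] and [2] are random, so both coordinates are required to be regular; this gives
the factor 2. -/
lemma FluidModel.measureReal_lt_abs_ruinTime_sub_sigmaStar_le (M : FluidModel)
    {θ : Fin 2 → ℕ → Ω → ℝ} {J : ∀ k, ℝ → Ω → M.State k} {θh : Fin 2 → ℕ → Ω → ℝ}
    {α β s x K T d : ℝ} {n N : ℕ}
    (hθ : ∀ c, IsPoissonArrivals P α (θ c)) (hθh : ∀ c, IsPoissonArrivals P β (θh c))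
    (hα : 0 < α) (hβ : 0 < β) (hs₀ : 0 ≤ s) (hs : s ≤ β / 2) (hn : 1 ≤ n) (hKT : K < T)
    (hN : K < (N - n) / β - x) (hd : (n + 1) / β + 2 * x ≤ d) (k : Fin 2) :
    P.real {ω | d < |(M.ruinTime J ω).toReal - M.sigmaStar θ J θh k ω| ∧
        M.ruinTime J ω ≤ (K : EReal)} ≤
      2 * (Real.exp (α * T) * (1 / 2) ^ n +
        (N + 1) * (2 * Real.exp (-(s * x) + N * (s / β) ^ 2))) := by
  have hsub : {ω | d < |(M.ruinTime J ω).toReal - M.sigmaStar θ J θh k ω| ∧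
      M.ruinTime J ω ≤ (K : EReal)} ⊆
      ⋃ c : Fin 2, {ω | ¬ IsRegularGrid β x T n N (θ c · ω) (θh c · ω)} := by
    rintro ω ⟨h1, h2⟩
    by_contra h3
    have h4 : ∀ c, IsRegularGrid β x T n N (θ c · ω) (θh c · ω) := fun c =>
      not_not.mp fun h => h3 (Set.mem_iUnion.mpr ⟨c, h⟩)
    exact absurd h1 (not_lt.mpr
      ((M.abs_ruinTime_sub_sigmaStar_le hβ hn hKT hN h4 h2 k).trans hd))
  calc _ ≤ _ := measureReal_mono hsub
    _ ≤ _ := measureReal_iUnion_fintype_le _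
    _ ≤ ∑ _c : Fin 2, _ := Finset.sum_le_sum fun c _ =>
        measureReal_not_isRegularGrid_le (hθ c) (hθh c) hα hβ hs₀ hs n N
    _ = _ := by rw [Finset.sum_const, Finset.card_univ, Fintype.card_fin, nsmul_eq_mul, Nat.cast_ofNat]

end Probability

/-! ### Choice of parameters as γ → ∞ -/

section Asymptotics

open Real

lemma eventually_mul_rpow_le_rpow {a b : ℝ} (h : a < b) (C : ℝ) :
    ∀ᶠ γ : ℝ in atTop, C * γ ^ a ≤ γ ^ b := by
  filter_upwards [(tendsto_rpow_atTop (sub_pos.mpr h)).eventually_ge_atTop C,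
    eventually_gt_atTop 0] with γ h1 h2
  calc C * γ ^ a ≤ γ ^ (b - a) * γ ^ a := by gcongr
    _ = γ ^ b := by rw [← rpow_add h2]; ring_nf

lemma eventually_exp_neg_rpow_le {p : ℝ} (hp : 0 < p) {c : ℝ} (hc : 0 < c) (b : ℝ) :
    ∀ᶠ γ : ℝ in atTop, exp (-(c * γ ^ p)) ≤ γ ^ b := by
  have h := ((isLittleO_exp_neg_mul_rpow_atTop hc (b / p)).comp_tendsto
    (tendsto_rpow_atTop hp)).bound one_pos
  filter_upwards [h, eventually_gt_atTop 0] with γ h1 h2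
  simp only [Function.comp_apply, one_mul, norm_eq_abs, abs_exp, neg_mul] at h1
  refine h1.trans_eq ?_
  rw [abs_of_nonneg (by positivity), ← rpow_mul h2.le, mul_div_cancel₀ _ hp.ne']

variable {ε q : ℝ}

/-- The deviation `log γ * γ ^ (-1/2 + ε/2)` tends to `0`. -/
lemma tendsto_log_mul_rpow_half (hε₁ : ε < 1) :
    Tendsto (fun γ : ℝ => log γ * γ ^ (-(1 / 2) + ε / 2 : ℝ)) atTop (𝓝 0) := by
  have h := (isLittleO_log_rpow_atTop (by linarith : 0 < 1 / 2 - ε / 2)).tendsto_div_nhds_zero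
  refine h.congr' ?_
  filter_upwards [eventually_gt_atTop 0] with γ hγ
  rw [div_eq_mul_inv, ← rpow_neg hγ.le]
  ring_nf

/-- The sum of the Chernoff bounds is negligible for a suitable choice of the parameters. -/
lemma eventually_chernoff_bound_le (hε₀ : 0 < ε) (hε₁ : ε < 1) (hq : 0 < q) {α : ℝ} (hα₀ : 0 < α) :
    ∀ᶠ γ : ℝ in atTop, ∃ (s x : ℝ) (n N : ℕ), 0 ≤ s ∧ s ≤ (γ - α) / 2 ∧ 1 ≤ n ∧
      γ ^ ε < (N - n) / (γ - α) - x ∧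
      (n + 1) / (γ - α) + 2 * x ≤ log γ * γ ^ (-(1 / 2) + ε / 2 : ℝ) ∧
      exp (α * (γ ^ ε + 1)) * (1 / 2) ^ n +
        (N + 1) * (2 * exp (-(s * x) + N * (s / (γ - α)) ^ 2)) ≤
      (1 + 8 * exp (256 * (q + 3) ^ 2)) * γ ^ (-(q + 1)) := by
  filter_upwards [eventually_ge_atTop (2 * α), eventually_ge_atTop 1,
    tendsto_log_atTop.eventually_ge_atTop 8,
    (tendsto_log_mul_rpow_half hε₁).eventually_le_const one_pos,
    (tendsto_rpow_atTop (by linarith : 0 < (1 + ε) / 2)).eventually_ge_atTop 2,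
    eventually_mul_rpow_le_rpow (by linarith : (1 - ε) / 2 < 1) (16 * (q + 3)),
    eventually_mul_rpow_le_rpow (by linarith : ε < (1 + ε) / 2) (8 * α),
    eventually_exp_neg_rpow_le (by linarith : 0 < (1 + ε) / 2) (by norm_num : (0 : ℝ) < 1 / 4)
      (-(q + 1))] with γ hα hγ₁ hlog hδ hy hs hexp hsmall
  have hγ : 0 < γ := by linarith
  rw [rpow_one] at hs
  set z := γ ^ (-(1 / 2) + ε / 2 : ℝ) with hz
  set y := γ ^ ((1 + ε) / 2) with hy_def
  set w := γ ^ ((1 - ε) / 2) with hw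
  set Y := γ ^ (1 + ε) with hY
  have hz₀ : 0 < z := rpow_pos_of_pos hγ _
  have hw₀ : 0 < w := rpow_pos_of_pos hγ _
  have hwz : w * z = 1 := by
    rw [hw, hz, ← rpow_add hγ, show (1 - ε) / 2 + (-(1 / 2) + ε / 2) = 0 by ring, rpow_zero]
  have hγz : γ * z = y := by
    rw [hz, hy_def]; nth_rw 1 [← rpow_one γ]; rw [← rpow_add hγ]; ring_nf
  have hyY : y * y = Y := by rw [hy_def, hY, ← rpow_add hγ]; ring_nf
  have hwY : w * w * Y = γ ^ 2 := by
    rw [hw, hY, ← rpow_add hγ, ← rpow_add hγ, ← rpow_natCast]; push_cast; ring_nf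
  have hγY : γ * γ ^ ε = Y := by rw [hY, rpow_add hγ, rpow_one]
  have hγε : 1 ≤ γ ^ ε := one_le_rpow hγ₁ hε₀.le
  have hYγ : Y ≤ γ ^ 2 := by
    rw [hY, ← rpow_natCast]; exact rpow_le_rpow_of_exponent_le hγ₁ (by push_cast; linarith)
  set β := γ - α with hβ_def
  have hβ : γ / 2 ≤ β := by linarith
  have hβ₀ : 0 < β := by linarith
  have hβ₂ : β ≤ γ := by linarith
  set n := ⌈y⌉₊ with hn_def
  set N := ⌈3 * Y⌉₊ with hN_def
  have hn₁ : y ≤ n := Nat.le_ceil _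
  have hn₂ : (n : ℝ) < y + 1 := Nat.ceil_lt_add_one (by linarith)
  have hY₄ : 4 ≤ Y := by nlinarith
  have hN₁ : 3 * Y ≤ N := Nat.le_ceil _
  have hN₂ : (N : ℝ) < 3 * Y + 1 := Nat.ceil_lt_add_one (by linarith)
  have hq₃ : 0 < q + 3 := by linarith
  -- Since w z = 1, the tilt s gives s x = (q + 3) log γ, while N (s/β)² stays bounded because w² Y
  -- = γ². N exceeds Y = γ · γ^ε threefold to absorb n and x.
  refine ⟨4 * (q + 3) * w, log γ * z / 4, n, N, by positivity, by linarith, ?_, ?_, ?_, ?_⟩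
  · exact Nat.one_le_ceil_iff.mpr (by linarith)
  · rw [lt_sub_iff_add_lt, lt_div_iff₀ hβ₀]
    have h1 : (γ ^ ε + log γ * z / 4) * β ≤ (γ ^ ε + 1 / 4) * γ := by gcongr
    nlinarith
  · have h1 : (n + 1) / β ≤ (2 * y) / (γ / 2) := by gcongr; linarith
    have h2 : (2 * y) / (γ / 2) = 4 * z := by rw [← hγz]; field_simp; norm_num
    -- Half of δ is 2x; the other half absorbs (n + 1)/β ≤ 4z once log γ ≥ 8.
    have h3 : 8 * z ≤ log γ * z := by gcongr
    linarith
  · have hfirst : exp (α * (γ ^ ε + 1)) * (1 / 2) ^ n ≤ γ ^ (-(q + 1)) := by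
      have h1 : (1 / 2 : ℝ) ^ n ≤ exp (-(n / 2)) := by
        calc (1 / 2 : ℝ) ^ n ≤ exp (-(1 / 2)) ^ n := by
              gcongr; linarith [add_one_le_exp (-(1 / 2) : ℝ)]
          _ = _ := by rw [← exp_nat_mul]; ring_nf
      have h2 : α * (γ ^ ε + 1) ≤ y / 4 := by nlinarith
      calc exp (α * (γ ^ ε + 1)) * (1 / 2) ^ n ≤ exp (y / 4) * exp (-(n / 2)) := by gcongr
        _ = exp (y / 4 - n / 2) := by rw [← exp_add]; ring_nf
        _ ≤ exp (-(1 / 4 * y)) := by gcongr; linarith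
        _ ≤ _ := hsmall
    -- The union bound has N + 1 ≤ 4γ² terms, hence the exponent q + 3 in the tilt.
    have hpow : γ ^ (-(q + 1)) = γ ^ 2 * γ ^ (-(q + 3)) := by
      rw [← rpow_natCast, ← rpow_add hγ]; push_cast; ring_nf
    have hsx : 4 * (q + 3) * w * (log γ * z / 4) = (q + 3) * log γ := by
      linear_combination (q + 3) * log γ * hwz
    have hvar : N * (4 * (q + 3) * w / β) ^ 2 ≤ 256 * (q + 3) ^ 2 := by
      calc N * (4 * (q + 3) * w / β) ^ 2 ≤ (4 * Y) * (4 * (q + 3) * w / (γ / 2)) ^ 2 := by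
            gcongr; linarith
        _ = 256 * (q + 3) ^ 2 * (w * w * Y) / γ ^ 2 := by field_simp; norm_num
        _ = _ := by rw [hwY]; field_simp
    have hexp₂ : exp (-(4 * (q + 3) * w * (log γ * z / 4)) + N * (4 * (q + 3) * w / β) ^ 2) ≤
        γ ^ (-(q + 3)) * exp (256 * (q + 3) ^ 2) := by
      rw [hsx, rpow_def_of_pos hγ, ← exp_add]
      gcongr
      linarith
    have hsecond : (N + 1) * (2 * exp (-(4 * (q + 3) * w * (log γ * z / 4)) +
        N * (4 * (q + 3) * w / β) ^ 2)) ≤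
        (4 * γ ^ 2) * (2 * (γ ^ (-(q + 3)) * exp (256 * (q + 3) ^ 2))) := by
      gcongr
      linarith
    calc _ ≤ _ := add_le_add hfirst hsecond
      _ = _ := by rw [hpow]; ring

lemma isLittleO_rpow_neg_add_one (q : ℝ) :
    (fun γ : ℝ => γ ^ (-(q + 1))) =o[atTop] fun γ : ℝ => γ ^ (-q) := by
  refine isLittleO_iff.mpr fun c hc => ?_
  filter_upwards [eventually_mul_rpow_le_rpow (by linarith : -(q + 1) < -q) c⁻¹,
    eventually_gt_atTop 0] with γ h1 h2
  rw [norm_of_nonneg (rpow_pos_of_pos h2 _).le, norm_of_nonneg (rpow_pos_of_pos h2 _).le]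
  rwa [inv_mul_le_iff₀ hc] at h1

end Asymptotics

theorem theorem2 (ε q : ℝ) (hε₀ : 0 < ε) (hε₁ : ε < 1) (hq : 0 < q) :
    ∃ δ K : ℝ → ℝ,
      (∃ c : ℝ, 0 < c ∧
        Tendsto (fun γ : ℝ => δ γ / (Real.log γ * γ ^ (-(1 / 2) + ε / 2 : ℝ))) atTop (𝓝 c)) ∧
      (∃ c : ℝ, 0 < c ∧ Tendsto (fun γ : ℝ => K γ / γ ^ ε) atTop (𝓝 c)) ∧
      ∀ (M : FluidModel) {Ω : Type*} [MeasurableSpace Ω] (P : Measure Ω) [IsProbabilityMeasure P]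
        (θ : Fin 2 → ℕ → Ω → ℝ) (J : ∀ k, ℝ → Ω → M.State k)
        (θhat : ℝ → Fin 2 → ℕ → Ω → ℝ),
        M.IsRuinFluidPair P θ J → M.IsRefinement P θ θhat →
        ∀ k : Fin 2,
          (fun γ : ℝ => P.real {ω | δ γ < |(M.ruinTime J ω).toReal - M.sigmaStar θ J (θhat γ) k ω| ∧
              M.ruinTime J ω ≤ (K γ : EReal)}) =o[atTop] fun γ : ℝ => γ ^ (-q)
  := by
  -- Both limits are 1. The model enters only through γ₀, which affects how large γ must be but not
  -- δ or K.
  refine ⟨fun γ => Real.log γ * γ ^ (-(1 / 2) + ε / 2 : ℝ), fun γ => γ ^ ε, ⟨1, one_pos, ?_⟩,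
    ⟨1, one_pos, ?_⟩, ?_⟩
  · refine tendsto_const_nhds.congr' ?_
    filter_upwards [eventually_gt_atTop 1] with γ hγ
    exact (div_self (mul_pos (Real.log_pos hγ)
      (Real.rpow_pos_of_pos (by linarith) _)).ne').symm
  · refine tendsto_const_nhds.congr' ?_
    filter_upwards [eventually_gt_atTop 0] with γ hγ
    exact (div_self (Real.rpow_pos_of_pos hγ _).ne').symm
  · intro M Ω _ P _ θ J θhat hJ hθhat k
    refine IsBigO.trans_isLittleO ?_ (isLittleO_rpow_neg_add_one q)
    refine IsBigO.of_bound (2 * (1 + 8 * Real.exp (256 * (q + 3) ^ 2))) ?_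
    filter_upwards [eventually_chernoff_bound_le hε₀ hε₁ hq M.γ₀_pos,
      eventually_gt_atTop M.γ₀] with γ ⟨s, x, n, N, hs₀, hs, hn, hN, hd, hbound⟩ hγ
    rw [Real.norm_of_nonneg measureReal_nonneg,
      Real.norm_of_nonneg (Real.rpow_nonneg (M.γ₀_pos.trans hγ).le _), mul_assoc]
    exact (M.measureReal_lt_abs_ruinTime_sub_sigmaStar_le hJ.poisson (hθhat.poisson γ hγ)
      M.γ₀_pos (sub_pos.mpr hγ) hs₀ hs hn (lt_add_one _) hN hd k).trans
      (mul_le_mul_of_nonneg_left hbound zero_le_two)
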